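/- Let $V$ be a finite non-empty set of vertices and let $a_{ij}\ge 0$ ($i,j\in V$) be constants. Consider the directed graph $\mathcal G$ on $V$ that has an edge from $j$ to $i$, of weight $a_{ij}$, whenever $j\neq i$ and $a_{ij}>0$. Let $\mathcal N_i$ be the set of vertices from which an edge is directed towards $i$. Let $L_c$ be the matrix with off-diagonal elements $-a_{ij}$ and diagonal elements $\sum_{j\ne i}a_{ij}$. A spanning tree directed from a vertex $r$ is a set of edges of $\mathcal G$ such that no edge of it enters $r$, no vertex is entered by more than one of its edges, and each vertex is reached from $r$ along its edges. Let $\sigma_i$ be the sum, over all spanning trees directed from $i$, of the products of the weights of their edges. Write $K\subseteq V$ for the set of vertices from which some spanning tree is directed, $\mathbb 1$ for the all-ones vector, and $\Sigma=\mathrm{diag}(\sigma_i)$. Solutions $x$ of $\dot x=-L_cx$ are considered on $[0,\infty)$. 1. $(L_cx)_i=\sum_{j\in\mathcal N_i}a_{ij}(x_i-x_j)$ for all $x\in\mathbb R^V$, $i\in V$; in particular $L_c\mathbb 1=0$. 2. (Matrix Tree theorem) For all $i,j$ the $(i,j)$ element of $\mathrm{adj}(L_c)$ (the transposed cofactor matrix)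 equals $\sigma_j$; and the row vector $\sigma$ satisfies $\sigma L_c=0$. 3. Along every solution $\frac{d}{dt}\sum_j\sigma_jx_j=0$, so that $\sum_j\sigma_jx_j(t)=\sum_j\sigma_jx_j(0)$ for all $t\ge0$. 4. $\sigma_j>0$ for $j\in K$ and $\sigma_j=0$ for $j\notin K$. Thus $\sigma\ne0$ if and only if there is a spanning tree ($K\neq\emptyset$). 5. A spanning tree exists if and only if every solution converges, as $t\to\infty$, to a vector of the form $c\mathbb 1$, $c\in\mathbb R$. In this case the consensus value is $$c=\frac{\sum_{j\in K}\sigma_jx_j(0)}{\sum_{j\in K}\sigma_j};$$ in particular, two solutions whose initial values agree on $K$ have the same consensus value. 6. $\mathcal G$ is strongly connected if and only if $\sigma_j>0$ for all $j$. In this case: (a) $\mathcal L_c:=\Sigma L_c$ is a balanced Laplacian matrix: its diagonal elements are nonnegative, its off-diagonal elements are nonpositive, and its row sums and column sums are zero; (b) $\tfrac12x^T\Sigma x$ is a positive definite function with $\frac{d}{dt}\tfrac12x^T\Sigma x=-x^T\mathcal L_cx\le0$ along every solution, and every solution converges to $c\mathbb 1$ with $c=\sum_j\sigma_jx_j(0)/\sum_j\sigma_j$;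 (c) with $\mathcal J=\tfrac12(\mathcal L_c^T-\mathcal L_c)$, $\mathcal R=\tfrac12(\mathcal L_c+\mathcal L_c^T)$ and $H(z)=\tfrac12z^T\Sigma^{-1}z$ one has $\mathcal L_c=-\mathcal J+\mathcal R$, $\mathcal J=-\mathcal J^T$, $\mathcal R=\mathcal R^T\ge0$ and $\frac{\partial H}{\partial z}(z)=\Sigma^{-1}z$. A function $x$ solves $\dot x=-L_cx$ if and only if $z=\Sigma x$ solves the port-Hamiltonian system $\dot z=[\mathcal J-\mathcal R]\frac{\partial H}{\partial z}(z)$; and if $x$ solves $\dot x=-L_cx$, then $z=\Sigma\dot x$ solves this system too. -/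

import Mathlib

open Matrix Filter Topology Set

namespace Consensus

variable {V : Type*}

/-- The directed graph of the weights `a`: there is an edge from `j` to `i` (along which agent `i`
receives the state of agent `j`) when `j ≠ i` and its weight `a i j` is positive. -/
def graph (a : V → V → ℝ) : Digraph V where
  Adj j i := j ≠ i ∧ 0 < a i j

/-- Any vertex can be reached from any other vertex by a sequence of directed edges. -/
def StronglyConnected (G : Digraph V) : Prop :=
  ∀ u v, Relation.ReflTransGen G.Adj u v

/-- `T`, a set of edges `(tail, head)`, is a spanning tree of `G` directed from the vertex `r`:
no edge of `T` enters `r`, no vertex is entered by two edges of `T`,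
and each vertex is reached from `r` along edges of `T`. -/
structure IsSpanningTreeFrom (G : Digraph V) (r : V) (T : Finset (V × V)) : Prop where
  adj : ∀ u v, (u, v) ∈ T → G.Adj u v
  root : ∀ u, (u, r) ∉ T
  parent_unique : ∀ u v w, (u, w) ∈ T → (v, w) ∈ T → u = v
  reach : ∀ v, Relation.ReflTransGen (fun u w => (u, w) ∈ T) r v

/-- There is a spanning tree of `G` directed from `r`. -/
def IsRoot (G : Digraph V) (r : V) : Prop :=
  ∃ T : Finset (V × V), IsSpanningTreeFrom G r T

variable [Fintype V]

open Classical in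
/-- The set `N_i` of the vertices from which there is an edge directed towards `i`. -/
noncomputable def inNeighbors (a : V → V → ℝ) (i : V) : Finset V :=
  Finset.univ.filter fun j => (graph a).Adj j i

open Classical in
/-- The vertices from which a spanning tree is directed. -/
noncomputable def roots (a : V → V → ℝ) : Finset V :=
  Finset.univ.filter fun j => IsRoot (graph a) j

open Classical in
/-- `σ_i`: the sum, over the spanning trees directed from `i`, of the product of the weights of
their edges (the edge from `u` to `v` has weight `a v u`). -/
noncomputable def sigma (a : V → V → ℝ) (i : V) : ℝ :=
  ∑ T ∈ Finset.univ.filter (fun T : Finset (V × V) => IsSpanningTreeFrom (graph a) i T),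
    ∏ e ∈ T, a e.2 e.1

variable [DecidableEq V]

/-- The consensus Laplacian `L_c`. -/
def laplacian (a : V → V → ℝ) : Matrix V V ℝ :=
  Matrix.of fun i j => if i = j then ∑ k ∈ Finset.univ.erase i, a i k else -a i j

/-- `x` solves `ẋ = -L_c x` for the times `t ≥ 0`. -/
def IsSolution (a : V → V → ℝ) (x : ℝ → V → ℝ) : Prop :=
  ∀ t, 0 ≤ t → HasDerivWithinAt x (-(laplacian a *ᵥ x t)) (Ici 0) t

/-- `Σ = diag(σ)`. -/
noncomputable def sigmaMat (a : V → V → ℝ) : Matrix V V ℝ :=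
  Matrix.diagonal (sigma a)

/-- `Σ L_c`. -/
noncomputable def scaledLaplacian (a : V → V → ℝ) : Matrix V V ℝ :=
  sigmaMat a * laplacian a

/-- `J` in the decomposition `Σ L_c = -J + R`. -/
noncomputable def structureMat (a : V → V → ℝ) : Matrix V V ℝ :=
  (1 / 2 : ℝ) • ((scaledLaplacian a)ᵀ - scaledLaplacian a)

/-- `R` in the decomposition `Σ L_c = -J + R`. -/
noncomputable def dissipationMat (a : V → V → ℝ) : Matrix V V ℝ :=
  (1 / 2 : ℝ) • (scaledLaplacian a + (scaledLaplacian a)ᵀ)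

/-- The Hamiltonian `H(z) = ½ zᵀ Σ⁻¹ z`. -/
noncomputable def hamiltonian (a : V → V → ℝ) (z : V → ℝ) : ℝ :=
  (1 / 2) * (z ⬝ᵥ ((sigmaMat a)⁻¹ *ᵥ z))

end Consensus

/-- A balanced Laplacian matrix: nonnegative diagonal elements, nonpositive off-diagonal elements,
zero row sums and zero column sums. -/
structure IsBalancedLaplacian {V : Type*} [Fintype V] (M : Matrix V V ℝ) : Prop where
  diag_nonneg : ∀ i, 0 ≤ M i i
  offDiag_nonpos : ∀ i j, i ≠ j → M i j ≤ 0
  row_sum : M *ᵥ 1 = 0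
  col_sum : 1 ᵥ* M = 0

/-- The vector `∂H/∂z` of partial derivatives of `H`. -/
noncomputable def partialGrad {V : Type*} [Fintype V] [DecidableEq V]
    (H : (V → ℝ) → ℝ) (z : V → ℝ) : V → ℝ :=
  fun i => fderiv ℝ H z (Pi.single i 1)

/-- The data of a port-Hamiltonian system without inputs and outputs and with constant structure
and dissipation matrices. -/
structure IsPortHamiltonian {V : Type*} [Fintype V]
    (J R : Matrix V V ℝ) (H : (V → ℝ) → ℝ) : Prop where
  skew : Jᵀ = -J
  psd : R.PosSemidef
  differentiable : Differentiable ℝ H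

/-- `z` solves `ż = [J - R] ∂H/∂z (z)` for the times `t ≥ 0`. -/
def IsPortHamiltonianSolution {V : Type*} [Fintype V] [DecidableEq V]
    (J R : Matrix V V ℝ) (H : (V → ℝ) → ℝ) (z : ℝ → V → ℝ) : Prop :=
  ∀ t, 0 ≤ t → HasDerivWithinAt z ((J - R) *ᵥ partialGrad H (z t)) (Ici 0) t

/-! Row `i` of the Laplacian is `∑ k, a i k • (e_i - e_k)`. Replace row `r` by `e_r` and expand the
determinant multilinearly: it becomes a sum over maps `f` choosing a parent for every vertex. The
determinant attached to `f` is `1` if all orbits of `f` end in `r` and `0` otherwise, and the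
surviving terms are exactly the spanning trees from `r` (`det_updateRow_laplacian_eq_sigma`). Zero
row sums extend this to all cofactors, and `adj(L) L = det(L) I = 0` gives `σ L = 0`, hence the
conserved quantity.

The same determinants tie graph to kernel: `σ_r = 0` yields a nonzero vector vanishing at `r` and
harmonic elsewhere. If `r` reaches every vertex, the maximum principle forbids it, so reachability
alone produces a tree (`isRoot_iff`). If there is no tree at all, a suitable `r` makes this vector a
nonconstant equilibrium, which rules out consensus.

With a tree from `r`, the flow `exp(-tL)` is stochastic for `t ≥ 0` and its column `r` is positive
at time `1`, so the oscillation of a solution decays geometrically (`mulVec_sub_mulVec_le`); the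
conserved quantity identifies the limit. In the strongly connected case `ΣL` is balanced, and its
quadratic form is a sum of squares. -/

namespace Consensus

variable {V : Type*}

/-! ### Signs of the tree weights. -/

section Sigma

variable {a : V → V → ℝ}

lemma IsRoot.reach {G : Digraph V} {r : V} (hr : IsRoot G r) (v : V) :
    Relation.ReflTransGen G.Adj r v := by
  obtain ⟨T, hT⟩ := hr
  exact Relation.ReflTransGen.mono (fun u w h => hT.adj u w h) _ _ (hT.reach v)

lemma prod_edges_pos {r : V} {T : Finset (V × V)}
    (hT : IsSpanningTreeFrom (graph a) r T) : 0 < ∏ e ∈ T, a e.2 e.1 :=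
  Finset.prod_pos fun e he => (hT.adj e.1 e.2 he).2

variable [Fintype V]

lemma sigma_pos {j : V} (hj : IsRoot (graph a) j) : 0 < sigma a j := by
  classical
  obtain ⟨T, hT⟩ := hj
  exact Finset.sum_pos (fun S hS => prod_edges_pos (Finset.mem_filter.mp hS).2) ⟨T, by simpa using hT⟩

lemma sigma_eq_zero {j : V} (hj : ¬ IsRoot (graph a) j) : sigma a j = 0 := by
  classical
  refine Finset.sum_eq_zero fun T hT => absurd ⟨T, by simpa using hT⟩ hj

lemma sigma_nonneg (a : V → V → ℝ) (j : V) : 0 ≤ sigma a j := by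
  by_cases hj : IsRoot (graph a) j
  · exact (sigma_pos hj).le
  · exact (sigma_eq_zero hj).ge

lemma sigma_pos_iff {j : V} : 0 < sigma a j ↔ IsRoot (graph a) j := by
  refine ⟨fun h => ?_, sigma_pos⟩
  by_contra hj
  exact h.ne' (sigma_eq_zero hj)

lemma sigma_ne_zero_iff : sigma a ≠ 0 ↔ ∃ r, IsRoot (graph a) r := by
  rw [Function.ne_iff]
  refine exists_congr fun r => ?_
  rw [← sigma_pos_iff]
  exact ⟨fun h => lt_of_le_of_ne (sigma_nonneg a r) (Ne.symm h), fun h => h.ne'⟩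

end Sigma

variable [Fintype V] [DecidableEq V]

/-! ### The Matrix Tree theorem. -/

section MatrixTree

/-- The matrix with the row `e_r` at `r` and the rows `e_i - e_{f i}` at the other vertices `i`. -/
def parentMatrix (r : V) (f : V → V) : Matrix V V ℝ :=
  Matrix.of fun i => if i = r then Pi.single r 1 else Pi.single i 1 - Pi.single (f i) 1

/-- The indicator of the vertices whose orbit misses `r` is a null vector: it vanishes at `r`,
agrees at `i` and `f i` for `i ≠ r`, and is nonzero at `v`. -/
lemma det_parentMatrix_eq_zero {r : V} {f : V → V} {v : V} (hv : ∀ n, f^[n] v ≠ r) :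
    (parentMatrix r f).det = 0 := by
  classical
  rw [← exists_mulVec_eq_zero_iff]
  refine ⟨fun w => if ∃ n, f^[n] w = r then 0 else 1, ?_, ?_⟩
  · intro h
    have := congrFun h v
    simp [hv] at this
  · ext i
    by_cases hi : i = r
    · have : ∃ n, f^[n] i = r := ⟨0, hi⟩
      subst hi
      simp [parentMatrix, mulVec, this]
    · have : (∃ n, f^[n] i = r) ↔ ∃ n, f^[n] (f i) = r := by
        constructor
        · rintro ⟨n, hn⟩
          cases n with
          | zero => exact absurd hn hi
          | succ n => exact ⟨n, by simpa using hn⟩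
        · rintro ⟨n, hn⟩
          exact ⟨n + 1, by simpa using hn⟩
      have hrow : parentMatrix r f i = Pi.single i 1 - Pi.single (f i) 1 :=
        if_neg hi
      change parentMatrix r f i ⬝ᵥ _ = 0
      rw [hrow, sub_dotProduct]
      simp [this]

/-- Only the identity survives in the Leibniz formula. A contributing permutation `π` satisfies `f
(π i) = i` wherever it moves `i`, so it strictly raises the distance to `r` there; but a permutation
preserves the total distance. -/
lemma det_parentMatrix_eq_one {r : V} {f : V → V} (h : ∀ v, ∃ n, f^[n] v = r) :
    (parentMatrix r f).det = 1 := by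
  classical
  let depth : V → ℕ := fun v => Nat.find (h v)
  have hdepth : ∀ i, i ≠ r → depth (f i) < depth i := by
    intro i hi
    have h1 : f^[depth i] i = r := Nat.find_spec (h i)
    obtain ⟨n, hn⟩ : ∃ n, depth i = n + 1 := by
      refine Nat.exists_eq_succ_of_ne_zero fun h0 => hi ?_
      simpa [h0] using h1
    have : depth (f i) ≤ n := Nat.find_min' (h (f i)) (by simpa [hn] using h1)
    omega
  have hfix : ∀ i, i ≠ r → f i ≠ i := fun i hi hf => by
    have := hdepth i hi
    rw [hf] at this
    exact lt_irrefl _ this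
  rw [det_apply', Finset.sum_eq_single 1]
  · have : ∀ i, parentMatrix r f i i = 1 := by
      intro i
      by_cases hi : i = r
      · subst hi; simp [parentMatrix]
      · simp [parentMatrix, hi, (hfix i hi).symm]
    simp [this]
  · intro π _ hπ
    by_contra hne
    have hprod : ∀ i, parentMatrix r f (π i) i ≠ 0 := fun i =>
      (Finset.prod_ne_zero_iff.mp (right_ne_zero_of_mul hne)) i (Finset.mem_univ i)
    have hcase : ∀ i, i ≠ π i → π i ≠ r ∧ f (π i) = i := by
      intro i hi
      have h1 := hprod i
      by_cases hr : π i = r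
      · simp only [parentMatrix, of_apply, hr, if_true] at h1
        rw [Pi.single_apply, if_neg (by rwa [hr] at hi)] at h1
        exact absurd rfl h1
      · refine ⟨hr, ?_⟩
        by_contra hf
        simp [parentMatrix, hr, hi, Ne.symm hf] at h1
    have hle : ∀ i ∈ Finset.univ, depth i ≤ depth (π i) := by
      intro i _
      by_cases hi : i = π i
      · rw [← hi]
      · obtain ⟨h1, h2⟩ := hcase i hi
        have := hdepth _ h1
        rw [h2] at this
        exact this.le
    have hsum : ∑ i, depth i = ∑ i, depth (π i) := (Equiv.sum_comp π depth).symm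
    rw [Finset.sum_eq_sum_iff_of_le hle] at hsum
    refine hπ (Equiv.ext fun i => ?_)
    by_contra hi
    obtain ⟨h1, h2⟩ := hcase i (Ne.symm hi)
    have h3 := hdepth _ h1
    rw [h2, hsum i (Finset.mem_univ i)] at h3
    exact lt_irrefl _ h3
  · simp

/-- The weight of choosing `k` as the parent of `i`, where the root `r` is its own parent. -/
def parentWeight (a : V → V → ℝ) (r i k : V) : ℝ :=
  if i = r then (if k = r then 1 else 0) else a i k

lemma laplacian_row (a : V → V → ℝ) (i : V) :
    laplacian a i = ∑ k, a i k • (Pi.single i 1 - Pi.single k 1 : V → ℝ) := by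
  ext j
  rw [Finset.sum_apply]
  by_cases hij : i = j
  · subst hij
    simp only [laplacian, of_apply, if_true]
    -- The term `k = i` is zero, so `a i i` plays no role.
    rw [← Finset.add_sum_erase _ _ (Finset.mem_univ i)]
    simp only [sub_self, smul_zero, Pi.zero_apply, zero_add]
    refine Finset.sum_congr rfl fun k hk => ?_
    simp [(Finset.ne_of_mem_erase hk).symm]
  · simp [laplacian, hij, Pi.single_apply, Ne.symm hij]

lemma det_updateRow_laplacian (a : V → V → ℝ) (r : V) :
    ((laplacian a).updateRow r (Pi.single r 1)).det =
      ∑ f : V → V, (∏ i, parentWeight a r i (f i)) * (parentMatrix r f).det := by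
  have hrow : (laplacian a).updateRow r (Pi.single r 1) = fun i => ∑ k, parentWeight a r i k •
      (if i = r then Pi.single r 1 else Pi.single i 1 - Pi.single k 1 : V → ℝ) := by
    funext i
    by_cases hi : i = r
    · subst hi
      rw [updateRow_self]
      simp [parentWeight]
    · rw [updateRow_ne hi, laplacian_row]
      simp [parentWeight, hi]
  rw [hrow]
  refine ((detRowAlternating (n := V) (R := ℝ)).toMultilinearMap.map_sum _).trans ?_
  refine Finset.sum_congr rfl fun f _ => ?_
  exact (detRowAlternating (n := V) (R := ℝ)).toMultilinearMap.map_smul_univ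
    (fun i => parentWeight a r i (f i)) (parentMatrix r f)

/-- The edges from the parent `f v` to `v`, for the vertices `v ≠ r`. -/
def parentEdges (r : V) (f : V → V) : Finset (V × V) :=
  (Finset.univ.erase r).image fun v => (f v, v)

lemma mem_parentEdges {r : V} {f : V → V} {u v : V} :
    (u, v) ∈ parentEdges r f ↔ v ≠ r ∧ f v = u := by
  simp only [parentEdges, Finset.mem_image, Finset.mem_erase, Finset.mem_univ, and_true,
    Prod.mk.injEq]
  constructor
  · rintro ⟨w, hw, h, rfl⟩
    exact ⟨hw, h⟩
  · rintro ⟨hv, h⟩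
    exact ⟨v, hv, h, rfl⟩

lemma isSpanningTreeFrom_parentEdges {G : Digraph V} {r : V} {f : V → V}
    (hadj : ∀ v, v ≠ r → G.Adj (f v) v) (hreach : ∀ v, ∃ n, f^[n] v = r) :
    IsSpanningTreeFrom G r (parentEdges r f) where
  adj u v h := by
    obtain ⟨hv, rfl⟩ := mem_parentEdges.mp h
    exact hadj v hv
  root u h := (mem_parentEdges.mp h).1 rfl
  parent_unique u v w hu hv := (mem_parentEdges.mp hu).2.symm.trans (mem_parentEdges.mp hv).2
  reach v := by
    obtain ⟨n, hn⟩ := hreach v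
    induction n generalizing v with
    | zero => exact hn ▸ Relation.ReflTransGen.refl
    | succ n ih =>
      by_cases hv : v = r
      · exact hv ▸ Relation.ReflTransGen.refl
      · exact (ih (f v) (by simpa using hn)).tail (mem_parentEdges.mpr ⟨hv, rfl⟩)

lemma IsSpanningTreeFrom.exists_parent {G : Digraph V} {r : V} {T : Finset (V × V)}
    (hT : IsSpanningTreeFrom G r T) :
    ∃ f : V → V, f r = r ∧ parentEdges r f = T ∧ ∀ v, ∃ n, f^[n] v = r := by
  classical
  -- A parent is the tail of the last edge on a path from `r`. Fixing `f r = r` makes the map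
  -- determined by the tree.
  have hpar : ∀ v, ∃ u, if v = r then u = r else (u, v) ∈ T := by
    intro v
    by_cases hv : v = r
    · exact ⟨r, by simp [hv]⟩
    · rcases (hT.reach v).cases_tail with h | ⟨u, -, hu⟩
      · exact absurd h hv
      · exact ⟨u, by simpa [hv] using hu⟩
  choose f hf using hpar
  have hfT : ∀ u v, (u, v) ∈ T ↔ v ≠ r ∧ f v = u := by
    intro u v
    constructor
    · intro h
      have hv : v ≠ r := fun hv => hT.root u (hv ▸ h)
      have h' := hf v
      rw [if_neg hv] at h'
      exact ⟨hv, hT.parent_unique _ _ _ h' h⟩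
    · rintro ⟨hv, rfl⟩
      have h' := hf v
      rwa [if_neg hv] at h'
  refine ⟨f, by simpa using hf r, ?_, fun v => ?_⟩
  · ext ⟨u, v⟩
    rw [mem_parentEdges, hfT]
  · induction hT.reach v with
    | refl => exact ⟨0, rfl⟩
    | tail _ h ih =>
      obtain ⟨n, hn⟩ := ih
      exact ⟨n + 1, by simpa [((hfT _ _).mp h).2] using hn⟩

lemma prod_parentWeight (a : V → V → ℝ) {r : V} {f : V → V} (hr : f r = r) :
    ∏ i, parentWeight a r i (f i) = ∏ e ∈ parentEdges r f, a e.2 e.1 := by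
  rw [parentEdges, Finset.prod_image (fun x _ y _ h => (Prod.mk.inj h).2),
    ← Finset.mul_prod_erase _ _ (Finset.mem_univ r)]
  simp only [parentWeight, hr, if_true, one_mul]
  refine Finset.prod_congr rfl fun i hi => ?_
  rw [if_neg (Finset.ne_of_mem_erase hi)]

/-- The principal cofactors of the Laplacian count the spanning trees. -/
theorem det_updateRow_laplacian_eq_sigma {a : V → V → ℝ} (ha : ∀ i j, 0 ≤ a i j) (r : V) :
    ((laplacian a).updateRow r (Pi.single r 1)).det = sigma a r := by
  classical
  rw [det_updateRow_laplacian, sigma]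
  have key : ∀ f : V → V, (∏ i, parentWeight a r i (f i)) * (parentMatrix r f).det ≠ 0 →
      f r = r ∧ (∀ v, ∃ n, f^[n] v = r) ∧ ∀ v, v ≠ r → (graph a).Adj (f v) v := by
    intro f hf
    have hw : ∀ i, parentWeight a r i (f i) ≠ 0 := fun i =>
      Finset.prod_ne_zero_iff.mp (left_ne_zero_of_mul hf) i (Finset.mem_univ i)
    have hreach : ∀ v, ∃ n, f^[n] v = r := by
      intro v
      by_contra! hv
      exact right_ne_zero_of_mul hf (det_parentMatrix_eq_zero hv)
    refine ⟨?_, hreach, fun v hv => ⟨fun hfv => ?_, ?_⟩⟩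
    · by_contra hr
      exact hw r (by simp [parentWeight, hr])
    -- A fixed point other than `r` never reaches `r`, which excludes self-loops even when `a v v >
    -- 0`.
    · obtain ⟨n, hn⟩ := hreach v
      rw [Function.iterate_fixed hfv] at hn
      exact hv hn
    · have := hw v
      rw [parentWeight, if_neg hv] at this
      exact lt_of_le_of_ne (ha _ _) this.symm
  refine Finset.sum_bij_ne_zero (fun f _ _ => parentEdges r f) ?_ ?_ ?_ ?_
  · intro f _ hf
    obtain ⟨-, h2, h3⟩ := key f hf
    simpa using isSpanningTreeFrom_parentEdges h3 h2
  · intro f _ hf g _ hg h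
    funext v
    by_cases hv : v = r
    · rw [hv, (key f hf).1, (key g hg).1]
    · have h1 : (f v, v) ∈ parentEdges r g := h ▸ mem_parentEdges.mpr ⟨hv, rfl⟩
      exact (mem_parentEdges.mp h1).2.symm
  · intro T hT _
    have hT' : IsSpanningTreeFrom (graph a) r T := by simpa using hT
    obtain ⟨f, hr, rfl, hreach⟩ := hT'.exists_parent
    refine ⟨f, Finset.mem_univ _, ?_, rfl⟩
    rw [prod_parentWeight a hr, det_parentMatrix_eq_one hreach, mul_one]
    exact (prod_edges_pos hT').ne'
  · intro f _ hf
    obtain ⟨h1, h2, -⟩ := key f hf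
    rw [prod_parentWeight a h1, det_parentMatrix_eq_one h2, mul_one]

lemma laplacian_mulVec_apply (a : V → V → ℝ) (v : V → ℝ) (i : V) :
    (laplacian a *ᵥ v) i = ∑ k, a i k * (v i - v k) := by
  rw [mulVec, laplacian_row, sum_dotProduct]
  simp [sub_dotProduct]

lemma laplacian_mulVec_one (a : V → V → ℝ) : laplacian a *ᵥ 1 = 0 := by
  ext i
  simp [laplacian_mulVec_apply]

lemma det_laplacian [Nonempty V] (a : V → V → ℝ) : (laplacian a).det = 0 :=
  exists_mulVec_eq_zero_iff.mp ⟨1, one_ne_zero, laplacian_mulVec_one a⟩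

/-- The Matrix Tree theorem. -/
theorem adjugate_laplacian {a : V → V → ℝ} (ha : ∀ i j, 0 ≤ a i j) (i j : V) :
    (laplacian a).adjugate i j = sigma a j := by
  rw [← det_updateRow_laplacian_eq_sigma ha, adjugate_apply]
  -- All rows of this matrix annihilate the all-ones vector, so exchanging `e_i` for `e_j` in row
  -- `j` leaves the determinant unchanged.
  have h0 : ((laplacian a).updateRow j (Pi.single i 1 - Pi.single j 1)).det = 0 := by
    refine exists_mulVec_eq_zero_iff.mp ⟨1, ?_, ?_⟩
    · exact fun h => one_ne_zero (congrFun h i)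
    · ext k
      by_cases hk : k = j
      · subst hk
        change (laplacian a).updateRow k (Pi.single i 1 - Pi.single k 1) k ⬝ᵥ 1 = 0
        rw [updateRow_self, sub_dotProduct]
        simp
      · have := congrFun (laplacian_mulVec_one a) k
        simpa [mulVec, updateRow_ne hk] using this
  have := det_updateRow_add (laplacian a) j (Pi.single i 1 - Pi.single j 1) (Pi.single j 1)
  rwa [sub_add_cancel, h0, zero_add] at this

theorem sigma_vecMul_laplacian [Nonempty V] {a : V → V → ℝ} (ha : ∀ i j, 0 ≤ a i j) :
    sigma a ᵥ* laplacian a = 0 := by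
  have h := adjugate_mul (laplacian a)
  rw [det_laplacian, zero_smul] at h
  obtain ⟨i⟩ := ‹Nonempty V›
  have : (laplacian a).adjugate i = sigma a := funext fun j => adjugate_laplacian ha i j
  rw [← this]
  exact congrFun h i

end MatrixTree

/-! ### Roots, reachability and the kernel of the Laplacian. -/

section Roots

variable {a : V → V → ℝ}

/-- Maximum principle: a function that is harmonic outside of `r` and vanishes at `r` is nonpositive
when each vertex is reached from `r`. -/
lemma nonpos_of_laplacian_eq_zero (ha : ∀ i j, 0 ≤ a i j) {r : V}
    (hr : ∀ v, Relation.ReflTransGen (graph a).Adj r v) {y : V → ℝ} (hy : y r = 0)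
    (hL : ∀ i, i ≠ r → (laplacian a *ᵥ y) i = 0) (v : V) : y v ≤ 0 := by
  have : Nonempty V := ⟨r⟩
  obtain ⟨m, hm⟩ := Finite.exists_max y
  -- The maximum is carried backwards along a path to `r`: at a harmonic maximum all terms `a w k *
  -- (y w - y k)` are nonnegative with sum zero, so each in-neighbour also attains it.
  suffices h : ∀ w, Relation.ReflTransGen (graph a).Adj r w → y w = y m → y m = 0 from
    (hm v).trans (h m (hr m) rfl).le
  intro w hw
  induction hw with
  | refl => exact fun h => h.symm.trans hy
  | @tail u w _ huw ih =>
    intro h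
    by_cases hwr : w = r
    · rw [← h, hwr, hy]
    · apply ih
      have h1 := hL w hwr
      rw [laplacian_mulVec_apply, Finset.sum_eq_zero_iff_of_nonneg] at h1
      · have h2 := h1 u (Finset.mem_univ u)
        have h3 := (mul_eq_zero.mp h2).resolve_left huw.2.ne'
        linarith
      · intro k _
        exact mul_nonneg (ha _ _) (by linarith [hm k])

/-- No tree is constructed: if there were none, `σ_r = 0` would give a nonzero `y` to which the
maximum principle applies, as well as to `-y`. -/
lemma isRoot_iff (ha : ∀ i j, 0 ≤ a i j) {r : V} :
    IsRoot (graph a) r ↔ ∀ v, Relation.ReflTransGen (graph a).Adj r v := by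
  refine ⟨IsRoot.reach, fun hr => ?_⟩
  by_contra hroot
  have h0 := det_updateRow_laplacian_eq_sigma ha r
  rw [sigma_eq_zero hroot, ← exists_mulVec_eq_zero_iff] at h0
  obtain ⟨y, hy0, hy⟩ := h0
  have hyr : y r = 0 := by simpa [mulVec] using congrFun hy r
  have hL : ∀ i, i ≠ r → (laplacian a *ᵥ y) i = 0 := fun i hi => by
    simpa [mulVec, updateRow_ne hi] using congrFun hy i
  refine hy0 (funext fun v => le_antisymm (nonpos_of_laplacian_eq_zero ha hr hyr hL v) ?_)
  have := nonpos_of_laplacian_eq_zero (y := -y) ha hr (by simp [hyr])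
    (fun i hi => by simp [mulVec_neg, hL i hi]) v
  simpa using this

lemma stronglyConnected_iff (ha : ∀ i j, 0 ≤ a i j) :
    StronglyConnected (graph a) ↔ ∀ j, 0 < sigma a j := by
  simp only [sigma_pos_iff, isRoot_iff ha, StronglyConnected]

/-- Without a spanning tree the Laplacian has a nonconstant null vector. -/
lemma exists_nonconstant_null_vector [Nonempty V] (ha : ∀ i j, 0 ≤ a i j)
    (h : ¬ ∃ r, IsRoot (graph a) r) :
    ∃ y : V → ℝ, laplacian a *ᵥ y = 0 ∧ ∀ c : ℝ, y ≠ fun _ => c := by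
  obtain ⟨w, hw0, hw⟩ := exists_vecMul_eq_zero_iff.mpr (det_laplacian a)
  obtain ⟨j, hj⟩ := Function.ne_iff.mp hw0
  have h0 := det_updateRow_laplacian_eq_sigma ha j
  rw [sigma_eq_zero fun hr => h ⟨j, hr⟩, ← exists_mulVec_eq_zero_iff] at h0
  obtain ⟨y, hy0, hy⟩ := h0
  have hyj : y j = 0 := by simpa [mulVec] using congrFun hy j
  have hL : ∀ i, i ≠ j → (laplacian a *ᵥ y) i = 0 := fun i hi => by
    simpa [mulVec, updateRow_ne hi] using congrFun hy i
  -- Pairing with the left null vector supplies the one missing equation, at `j`, because `w j ≠ 0`.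
  have hdot : w ⬝ᵥ (laplacian a *ᵥ y) = 0 := by rw [dotProduct_mulVec, hw, zero_dotProduct]
  rw [dotProduct, Finset.sum_eq_single j (fun i _ hi => by simp [hL i hi]) (by simp)] at hdot
  refine ⟨y, funext fun i => ?_, fun c hc => hy0 ?_⟩
  · by_cases hi : i = j
    · exact hi ▸ (mul_eq_zero.mp hdot).resolve_left hj
    · exact hL i hi
  · have : c = 0 := by rw [hc] at hyj; exact hyj
    rw [hc, this]
    rfl

end Roots

/-! ### Conserved quantity and equilibria. -/

section Conservation

lemma eq_of_hasDerivWithinAt_zero {E : Type*} [NormedAddCommGroup E] [NormedSpace ℝ E] {f : ℝ → E}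
    (hf : ∀ t, 0 ≤ t → HasDerivWithinAt f 0 (Ici 0) t) {t : ℝ} (ht : 0 ≤ t) : f t = f 0 := by
  refine constant_of_has_deriv_right_zero (a := 0) (b := t) ?_ ?_ t ⟨ht, le_rfl⟩
  · exact fun s hs => ((hf s hs.1).continuousWithinAt).mono Icc_subset_Ici_self
  · exact fun s hs => (hf s hs.1).mono (Ici_subset_Ici.mpr hs.1)

variable {V : Type*} [Fintype V] [DecidableEq V] {a : V → V → ℝ} {x : ℝ → V → ℝ}

lemma IsSolution.hasDerivWithinAt_apply (hx : IsSolution a x) {t : ℝ} (ht : 0 ≤ t) (i : V) :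
    HasDerivWithinAt (fun s => x s i) (-(laplacian a *ᵥ x t) i) (Ici 0) t :=
  hasDerivWithinAt_pi.mp (hx t ht) i

lemma IsSolution.hasDerivWithinAt_sum_sigma [Nonempty V] (ha : ∀ i j, 0 ≤ a i j)
    (hx : IsSolution a x) {t : ℝ} (ht : 0 ≤ t) :
    HasDerivWithinAt (fun s => ∑ j, sigma a j * x s j) 0 (Ici 0) t := by
  have h : HasDerivWithinAt (fun s => ∑ j, sigma a j * x s j)
      (∑ j, sigma a j * -(laplacian a *ᵥ x t) j) (Ici 0) t :=
    HasDerivWithinAt.fun_sum fun j _ => (hx.hasDerivWithinAt_apply ht j).const_mul _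
  convert h using 1
  have : sigma a ⬝ᵥ (laplacian a *ᵥ x t) = 0 := by
    rw [dotProduct_mulVec, sigma_vecMul_laplacian ha, zero_dotProduct]
  simp only [mul_neg, Finset.sum_neg_distrib]
  rw [← dotProduct, this, neg_zero]

lemma IsSolution.sum_sigma_eq [Nonempty V] (ha : ∀ i j, 0 ≤ a i j)
    (hx : IsSolution a x) {t : ℝ} (ht : 0 ≤ t) :
    ∑ j, sigma a j * x t j = ∑ j, sigma a j * x 0 j :=
  eq_of_hasDerivWithinAt_zero (f := fun s => ∑ j, sigma a j * x s j)
    (fun _ hs => hx.hasDerivWithinAt_sum_sigma ha hs) ht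

lemma isSolution_const {y : V → ℝ} (hy : laplacian a *ᵥ y = 0) : IsSolution a fun _ => y := by
  intro t _
  rw [hy, neg_zero]
  exact hasDerivWithinAt_const _ _ _

end Conservation

/-! ### The flow as a stochastic matrix. -/

section Exponential

open scoped Matrix.Norms.Operator

variable {V : Type*} [Fintype V] [DecidableEq V]

lemma pow_apply_nonneg {A : Matrix V V ℝ} (hA : ∀ i j, 0 ≤ A i j) (n : ℕ) (i j : V) :
    0 ≤ (A ^ n) i j := by
  induction n generalizing i j with
  | zero => rw [pow_zero, one_apply]; split_ifs <;> norm_num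
  | succ n ih =>
    rw [pow_succ, mul_apply]
    exact Finset.sum_nonneg fun k _ => mul_nonneg (ih i k) (hA k j)

lemma exists_pow_apply_pos {A : Matrix V V ℝ} (hA : ∀ i j, 0 ≤ A i j) {r : V → V → Prop}
    (hr : ∀ u v, r u v → 0 < A v u) {u v : V} (h : Relation.ReflTransGen r u v) :
    ∃ n, 0 < (A ^ n) v u := by
  induction h with
  | refl => exact ⟨0, by simp⟩
  | @tail w v _ hwv ih =>
    obtain ⟨n, hn⟩ := ih
    refine ⟨n + 1, ?_⟩
    rw [pow_succ', mul_apply]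
    exact Finset.sum_pos' (fun k _ => mul_nonneg (hA v k) (pow_apply_nonneg hA n k u))
      ⟨w, Finset.mem_univ w, mul_pos (hr w v hwv) hn⟩

lemma hasSum_exp_apply (A : Matrix V V ℝ) (i j : V) :
    HasSum (fun n : ℕ => (n.factorial : ℝ)⁻¹ * (A ^ n) i j) (NormedSpace.exp A i j) := by
  have h := NormedSpace.exp_series_hasSum_exp' (𝕂 := ℝ) A
  exact Pi.hasSum.mp (Pi.hasSum.mp h i) j

lemma exp_apply_nonneg {A : Matrix V V ℝ} (hA : ∀ i j, 0 ≤ A i j) (i j : V) :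
    0 ≤ NormedSpace.exp A i j :=
  (hasSum_exp_apply A i j).nonneg fun n =>
    mul_nonneg (by positivity) (pow_apply_nonneg hA n i j)

lemma exp_apply_pos {A : Matrix V V ℝ} (hA : ∀ i j, 0 ≤ A i j) {i j : V} {n : ℕ}
    (hn : 0 < (A ^ n) i j) : 0 < NormedSpace.exp A i j := by
  refine lt_of_lt_of_le (mul_pos (by positivity) hn) (le_hasSum (hasSum_exp_apply A i j) n ?_)
  exact fun m _ => mul_nonneg (by positivity) (pow_apply_nonneg hA m i j)

/-- The flow `exp (-t L_c)` of the consensus dynamics. -/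
noncomputable def flow (a : V → V → ℝ) (t : ℝ) : Matrix V V ℝ :=
  NormedSpace.exp (t • -laplacian a)

variable {a : V → V → ℝ} {x : ℝ → V → ℝ}

lemma flow_add (a : V → V → ℝ) (s t : ℝ) : flow a (s + t) = flow a s * flow a t := by
  rw [flow, add_smul]
  exact Matrix.exp_add_of_commute _ _ (((Commute.refl _).smul_left s).smul_right t)

/-- Uniqueness by an integrating factor: `exp(tL) x(t)` has zero derivative. -/
lemma IsSolution.eq_flow_mulVec (hx : IsSolution a x) {t : ℝ} (ht : 0 ≤ t) :
    x t = flow a t *ᵥ x 0 := by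
  have hE : ∀ s : ℝ, HasDerivAt (fun u : ℝ => NormedSpace.exp (u • laplacian a))
      (NormedSpace.exp (s • laplacian a) * laplacian a) s :=
    fun s => hasDerivAt_exp_smul_const (laplacian a) s
  have hEa : ∀ (s : ℝ) (i j : V), HasDerivAt (fun u : ℝ => NormedSpace.exp (u • laplacian a) i j)
      ((NormedSpace.exp (s • laplacian a) * laplacian a) i j) s :=
    fun s i j => hasDerivAt_pi.mp (hasDerivAt_pi.mp (hE s) i) j
  have hconst : ∀ s, 0 ≤ s → HasDerivWithinAt
      (fun u : ℝ => NormedSpace.exp (u • laplacian a) *ᵥ x u) 0 (Ici 0) s := by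
    intro s hs
    refine hasDerivWithinAt_pi.mpr fun i => ?_
    have h : HasDerivWithinAt (fun u : ℝ => ∑ j, NormedSpace.exp (u • laplacian a) i j * x u j)
        (∑ j, ((NormedSpace.exp (s • laplacian a) * laplacian a) i j * x s j +
          NormedSpace.exp (s • laplacian a) i j * -(laplacian a *ᵥ x s) j)) (Ici 0) s :=
      HasDerivWithinAt.fun_sum fun j _ =>
        (hEa s i j).hasDerivWithinAt.mul (hx.hasDerivWithinAt_apply hs j)
    have h2 : ((NormedSpace.exp (s • laplacian a) * laplacian a) *ᵥ x s) i =
        (NormedSpace.exp (s • laplacian a) *ᵥ (laplacian a *ᵥ x s)) i := by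
      rw [mulVec_mulVec]
    simp only [Finset.sum_add_distrib, mul_neg, Finset.sum_neg_distrib] at h
    exact h.congr_deriv (add_neg_eq_zero.mpr h2)
  have h := eq_of_hasDerivWithinAt_zero hconst ht
  simp only [zero_smul, NormedSpace.exp_zero, one_mulVec] at h
  rw [← h, mulVec_mulVec, flow, ← Matrix.exp_add_of_commute]
  · simp
  · exact (((Commute.refl (laplacian a)).neg_left).smul_left t).smul_right t

lemma flow_mulVec_one (a : V → V → ℝ) {t : ℝ} (ht : 0 ≤ t) : flow a t *ᵥ 1 = 1 :=
  ((isSolution_const (laplacian_mulVec_one a)).eq_flow_mulVec ht).symm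

lemma sum_flow_apply (a : V → V → ℝ) {t : ℝ} (ht : 0 ≤ t) (i : V) : ∑ j, flow a t i j = 1 := by
  simpa [mulVec, dotProduct] using congrFun (flow_mulVec_one a ht) i

lemma IsSolution.add_eq_flow_mulVec (hx : IsSolution a x) {s t : ℝ} (hs : 0 ≤ s) (ht : 0 ≤ t) :
    x (s + t) = flow a s *ᵥ x t := by
  rw [hx.eq_flow_mulVec (add_nonneg hs ht), hx.eq_flow_mulVec ht, mulVec_mulVec, flow_add]

/-- The nonnegative matrix `c I - L_c`, where `c` is the trace of `L_c`. -/
def shiftedLaplacian (a : V → V → ℝ) : Matrix V V ℝ :=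
  (laplacian a).trace • (1 : Matrix V V ℝ) - laplacian a

lemma shiftedLaplacian_apply_of_ne (a : V → V → ℝ) {i j : V} (h : i ≠ j) :
    shiftedLaplacian a i j = a i j := by
  simp [shiftedLaplacian, laplacian, h]

lemma laplacian_diag_nonneg (ha : ∀ i j, 0 ≤ a i j) (i : V) : 0 ≤ laplacian a i i := by
  rw [laplacian, of_apply, if_pos rfl]
  exact Finset.sum_nonneg fun k _ => ha i k

lemma shiftedLaplacian_nonneg (ha : ∀ i j, 0 ≤ a i j) (i j : V) : 0 ≤ shiftedLaplacian a i j := by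
  by_cases h : i = j
  · subst h
    have : laplacian a i i ≤ (laplacian a).trace :=
      Finset.single_le_sum (f := fun k => laplacian a k k)
        (fun k _ => laplacian_diag_nonneg ha k) (Finset.mem_univ i)
    simpa [shiftedLaplacian] using this
  · rw [shiftedLaplacian_apply_of_ne a h]
    exact ha i j

/-- Multiples of the identity commute with everything, so the shift only costs a positive scalar.
Positivity of the flow is thus read off the power series of a nonnegative matrix. -/
lemma flow_eq_smul_exp (a : V → V → ℝ) (t : ℝ) :
    flow a t = Real.exp (-(t * (laplacian a).trace)) • NormedSpace.exp (t • shiftedLaplacian a) := by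
  have h : t • -laplacian a =
      (-(t * (laplacian a).trace)) • (1 : Matrix V V ℝ) + t • shiftedLaplacian a := by
    rw [shiftedLaplacian, smul_sub, smul_smul, smul_neg, neg_smul]
    abel
  rw [flow, h, Matrix.exp_add_of_commute _ _ ((Commute.one_left _).smul_left _),
    smul_one_eq_diagonal, Matrix.exp_diagonal, Pi.exp_def, Real.exp_eq_exp_ℝ,
    smul_eq_diagonal_mul (NormedSpace.exp (t • shiftedLaplacian a))]

lemma flow_nonneg (ha : ∀ i j, 0 ≤ a i j) {t : ℝ} (ht : 0 ≤ t) (i j : V) : 0 ≤ flow a t i j := by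
  rw [flow_eq_smul_exp]
  refine mul_nonneg (Real.exp_pos _).le (exp_apply_nonneg (fun k l => ?_) i j)
  exact mul_nonneg ht (shiftedLaplacian_nonneg ha k l)

lemma flow_one_pos (ha : ∀ i j, 0 ≤ a i j) {r : V} (hr : IsRoot (graph a) r) (i : V) :
    0 < flow a 1 i r := by
  rw [flow_eq_smul_exp, one_smul]
  obtain ⟨n, hn⟩ := exists_pow_apply_pos (shiftedLaplacian_nonneg ha) (r := (graph a).Adj)
    (fun u v h => by rw [shiftedLaplacian_apply_of_ne a h.1.symm]; exact h.2) (hr.reach i)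
  exact mul_pos (Real.exp_pos _) (exp_apply_pos (shiftedLaplacian_nonneg ha) hn)

end Exponential

/-! ### Contraction of oscillation and consensus. -/

section Convergence

variable {V : Type*} [Fintype V]

/-- A stochastic matrix with a column bounded below by `δ` contracts the oscillation of vectors. -/
lemma mulVec_sub_mulVec_le {P : Matrix V V ℝ} (hP : ∀ i j, 0 ≤ P i j) (hsum : ∀ i, ∑ j, P i j = 1)
    {r : V} {δ : ℝ} (hδ : 0 ≤ δ) (hr : ∀ i, δ ≤ P i r) {y : V → ℝ} {D : ℝ}
    (hy : ∀ i j, y i - y j ≤ D) (i j : V) :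
    (P *ᵥ y) i - (P *ᵥ y) j ≤ (1 - δ ^ 2) * D := by
  classical
  have hD : 0 ≤ D := by simpa using hy r r
  -- Since rows sum to one, the difference is an average of `y k - y l` over independent `k`, `l`.
  -- The pair `(r, r)` has weight at least `δ ^ 2` and contributes `0` instead of `D`.
  have h1 : (P *ᵥ y) i - (P *ᵥ y) j = ∑ k, ∑ l, P i k * P j l * (y k - y l) := by
    have e1 : (P *ᵥ y) i = ∑ k, ∑ l, P i k * P j l * y k := by
      refine Finset.sum_congr rfl fun k _ => ?_
      rw [← Finset.sum_mul, ← Finset.mul_sum, hsum, mul_one]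
    have e2 : (P *ᵥ y) j = ∑ k, ∑ l, P i k * P j l * y l := by
      rw [Finset.sum_comm]
      refine Finset.sum_congr rfl fun l _ => ?_
      rw [← Finset.sum_mul, ← Finset.sum_mul, hsum, one_mul]
    simp only [e1, e2, mul_sub, Finset.sum_sub_distrib]
  have h2 : ∑ k, ∑ l, P i k * P j l * (y k - y l) ≤
      ∑ k, ∑ l, (P i k * P j l * D - if k = r then (if l = r then P i r * P j r * D else 0) else 0) := by
    refine Finset.sum_le_sum fun k _ => Finset.sum_le_sum fun l _ => ?_
    have hkl := mul_le_mul_of_nonneg_left (hy k l) (mul_nonneg (hP i k) (hP j l))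
    split_ifs with hk hl
    · subst hk hl
      simp
    · simpa using hkl
    · simpa using hkl
  have h3 : ∑ k, ∑ l, (P i k * P j l * D - if k = r then (if l = r then P i r * P j r * D else 0) else 0)
      = D - P i r * P j r * D := by
    simp only [Finset.sum_sub_distrib]
    congr 1
    · simp only [← Finset.sum_mul, ← Finset.mul_sum, hsum, mul_one, one_mul]
    · simp
  have h4 : δ ^ 2 * D ≤ P i r * P j r * D := by
    refine mul_le_mul_of_nonneg_right ?_ hD
    rw [sq]
    exact mul_le_mul (hr i) (hr j) hδ (hP i r)
  rw [h1]
  refine (h2.trans h3.le).trans ?_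
  linarith

lemma sum_sigma_pos {a : V → V → ℝ} {r : V} (hr : IsRoot (graph a) r) : 0 < ∑ j, sigma a j :=
  Finset.sum_pos' (fun j _ => sigma_nonneg a j) ⟨r, Finset.mem_univ r, sigma_pos hr⟩

lemma sum_roots_eq (a : V → V → ℝ) (y : V → ℝ) :
    ∑ j ∈ roots a, sigma a j * y j = ∑ j, sigma a j * y j := by
  classical
  refine Finset.sum_subset (Finset.subset_univ _) fun j _ hj => ?_
  rw [sigma_eq_zero (by simpa [roots] using hj), zero_mul]

variable [DecidableEq V] {a : V → V → ℝ} {x : ℝ → V → ℝ}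

lemma IsSolution.exists_tendsto_zero_bound (ha : ∀ i j, 0 ≤ a i j) {r : V}
    (hr : IsRoot (graph a) r) (hx : IsSolution a x) :
    ∃ b : ℝ → ℝ, Tendsto b atTop (𝓝 0) ∧ ∀ t, 0 ≤ t → ∀ i j, x t i - x t j ≤ b t := by
  have : Nonempty V := ⟨r⟩
  obtain ⟨m, hm⟩ := Finite.exists_min fun i => flow a 1 i r
  have hδ : 0 < flow a 1 m r := flow_one_pos ha hr m
  have hδ1 : flow a 1 m r ≤ 1 := by
    refine (Finset.single_le_sum (f := fun j => flow a 1 m j)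
      (fun j _ => flow_nonneg ha zero_le_one m j) (Finset.mem_univ r)).trans_eq ?_
    exact sum_flow_apply a zero_le_one m
  obtain ⟨D, hD⟩ := (Set.finite_range fun p : V × V => x 0 p.1 - x 0 p.2).bddAbove
  have hstep : ∀ n : ℕ, ∀ i j, x n i - x n j ≤ (1 - flow a 1 m r ^ 2) ^ n * D := by
    intro n
    induction n with
    | zero =>
      intro i j
      simpa using hD ⟨(i, j), rfl⟩
    | succ n ih =>
      intro i j
      have h := mulVec_sub_mulVec_le (flow_nonneg ha zero_le_one) (sum_flow_apply a zero_le_one)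
        hδ.le hm ih i j
      rw [← hx.add_eq_flow_mulVec zero_le_one n.cast_nonneg] at h
      rw [Nat.cast_succ, add_comm (n : ℝ) 1, pow_succ', mul_assoc]
      exact h
  refine ⟨fun t => (1 - flow a 1 m r ^ 2) ^ ⌊t⌋₊ * D, ?_, fun t ht i j => ?_⟩
  · have h1 : Tendsto (fun n : ℕ => (1 - flow a 1 m r ^ 2) ^ n) atTop (𝓝 0) :=
      tendsto_pow_atTop_nhds_zero_of_lt_one (by nlinarith) (by nlinarith)
    simpa using (h1.comp (tendsto_nat_floor_atTop (α := ℝ))).mul_const D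
  · have hs : 0 ≤ t - ⌊t⌋₊ := sub_nonneg.mpr (Nat.floor_le ht)
    -- With `δ = 0`: over the remaining fraction of a time unit the oscillation merely does not
    -- grow.
    have h := mulVec_sub_mulVec_le (flow_nonneg ha hs) (sum_flow_apply a hs) (r := r)
        le_rfl (fun k => flow_nonneg ha hs k r) (hstep ⌊t⌋₊) i j
    rw [← hx.add_eq_flow_mulVec hs (Nat.cast_nonneg _)] at h
    simpa using h

theorem IsSolution.tendsto_consensus (ha : ∀ i j, 0 ≤ a i j) {r : V}
    (hr : IsRoot (graph a) r) (hx : IsSolution a x) :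
    Tendsto x atTop (𝓝 fun _ => (∑ j, sigma a j * x 0 j) / ∑ j, sigma a j) := by
  have : Nonempty V := ⟨r⟩
  obtain ⟨b, hb, hxb⟩ := hx.exists_tendsto_zero_bound ha hr
  have hS := sum_sigma_pos hr
  refine tendsto_pi_nhds.mpr fun i => ?_
  rw [tendsto_iff_norm_sub_tendsto_zero]
  refine squeeze_zero' (Eventually.of_forall fun t => norm_nonneg _) ?_ hb
  filter_upwards [eventually_ge_atTop 0] with t ht
  rw [← hx.sum_sigma_eq ha ht]
  -- By conservation the limit is the weighted mean of the current state, so the deviation from it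
  -- is an average of differences.
  have h : x t i - (∑ j, sigma a j * x t j) / ∑ j, sigma a j =
      (∑ j, sigma a j * (x t i - x t j)) / ∑ j, sigma a j := by
    simp only [mul_sub, Finset.sum_sub_distrib, ← Finset.sum_mul]
    field_simp
  rw [h, Real.norm_eq_abs, abs_div, abs_of_pos hS, div_le_iff₀ hS, mul_comm, Finset.sum_mul]
  refine (Finset.abs_sum_le_sum_abs _ _).trans (Finset.sum_le_sum fun j _ => ?_)
  rw [abs_mul, abs_of_nonneg (sigma_nonneg a j)]
  refine mul_le_mul_of_nonneg_left (abs_le.mpr ⟨?_, hxb t ht i j⟩) (sigma_nonneg a j)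
  linarith [hxb t ht j i]

lemma exists_isRoot_iff_forall_tendsto [Nonempty V] (ha : ∀ i j, 0 ≤ a i j) :
    (∃ r, IsRoot (graph a) r) ↔
      ∀ x, IsSolution a x → ∃ c : ℝ, Tendsto x atTop (𝓝 fun _ => c) := by
  refine ⟨fun ⟨r, hr⟩ x hx => ⟨_, hx.tendsto_consensus ha hr⟩, fun h => ?_⟩
  by_contra hroot
  obtain ⟨y, hy, hc⟩ := exists_nonconstant_null_vector ha hroot
  obtain ⟨c, hlim⟩ := h _ (isSolution_const hy)
  exact hc c (tendsto_nhds_unique tendsto_const_nhds hlim)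

end Convergence

end Consensus

/-! ### The quadratic form of a balanced Laplacian. -/

/-- On expanding the squares, zero row sums remove the `x i ^ 2` terms and zero column sums the `x j
^ 2` terms; no symmetry is needed. -/
lemma IsBalancedLaplacian.dotProduct_mulVec {V : Type*} [Fintype V] {M : Matrix V V ℝ}
    (hM : IsBalancedLaplacian M) (x : V → ℝ) :
    x ⬝ᵥ (M *ᵥ x) = 1 / 2 * ∑ i, ∑ j, -M i j * (x i - x j) ^ 2 := by
  have hrow : ∀ i, ∑ j, M i j = 0 := fun i => by
    simpa [mulVec, dotProduct] using congrFun hM.row_sum i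
  have hcol : ∀ j, ∑ i, M i j = 0 := fun j => by
    simpa [vecMul, dotProduct] using congrFun hM.col_sum j
  have h1 : ∑ i, ∑ j, M i j * x i ^ 2 = 0 :=
    Finset.sum_eq_zero fun i _ => by rw [← Finset.sum_mul, hrow, zero_mul]
  have h2 : ∑ i, ∑ j, M i j * x j ^ 2 = 0 := by
    rw [Finset.sum_comm]
    exact Finset.sum_eq_zero fun j _ => by rw [← Finset.sum_mul, hcol, zero_mul]
  have h3 : ∑ i, ∑ j, -M i j * (x i - x j) ^ 2 =
      2 * ∑ i, ∑ j, x i * (M i j * x j) - ∑ i, ∑ j, M i j * x i ^ 2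
        - ∑ i, ∑ j, M i j * x j ^ 2 := by
    simp only [Finset.mul_sum, ← Finset.sum_sub_distrib]
    exact Finset.sum_congr rfl fun i _ => Finset.sum_congr rfl fun j _ => by ring
  rw [h3, h1, h2]
  simp only [dotProduct, mulVec, Finset.mul_sum]
  rw [sub_zero, sub_zero, Finset.mul_sum]
  refine Finset.sum_congr rfl fun i _ => ?_
  rw [Finset.mul_sum]
  exact Finset.sum_congr rfl fun j _ => by ring

lemma IsBalancedLaplacian.dotProduct_mulVec_nonneg {V : Type*} [Fintype V] {M : Matrix V V ℝ}
    (hM : IsBalancedLaplacian M) (x : V → ℝ) : 0 ≤ x ⬝ᵥ (M *ᵥ x) := by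
  rw [hM.dotProduct_mulVec]
  refine mul_nonneg (by norm_num) (Finset.sum_nonneg fun i _ => Finset.sum_nonneg fun j _ => ?_)
  by_cases h : i = j
  · simp [h]
  · exact mul_nonneg (neg_nonneg.mpr (hM.offDiag_nonpos i j h)) (sq_nonneg _)

/-! ### Lyapunov function and port-Hamiltonian form. -/

namespace Consensus

variable {V : Type*} [Fintype V] [DecidableEq V] {a : V → V → ℝ}

lemma laplacian_mulVec_eq_sum_inNeighbors (ha : ∀ i j, 0 ≤ a i j) (v : V → ℝ) (i : V) :
    (laplacian a *ᵥ v) i = ∑ j ∈ inNeighbors a i, a i j * (v i - v j) := by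
  classical
  rw [laplacian_mulVec_apply]
  refine (Finset.sum_subset (Finset.subset_univ _) fun j _ hj => ?_).symm
  have hj' : j ≠ i → ¬ 0 < a i j := fun h1 h2 => hj (by simpa [inNeighbors] using ⟨h1, h2⟩)
  by_cases h : j = i
  · simp [h]
  · rw [le_antisymm (not_lt.mp (hj' h)) (ha i j), zero_mul]

lemma scaledLaplacian_apply (a : V → V → ℝ) (i j : V) :
    scaledLaplacian a i j = sigma a i * laplacian a i j := by
  simp [scaledLaplacian, sigmaMat, diagonal_mul]

lemma isBalancedLaplacian_scaledLaplacian [Nonempty V] (ha : ∀ i j, 0 ≤ a i j) :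
    IsBalancedLaplacian (scaledLaplacian a) where
  diag_nonneg i := by
    rw [scaledLaplacian_apply]
    exact mul_nonneg (sigma_nonneg a i) (laplacian_diag_nonneg ha i)
  offDiag_nonpos i j h := by
    rw [scaledLaplacian_apply]
    refine mul_nonpos_of_nonneg_of_nonpos (sigma_nonneg a i) ?_
    simpa [laplacian, h] using ha i j
  row_sum := by
    rw [scaledLaplacian, ← mulVec_mulVec, laplacian_mulVec_one, mulVec_zero]
  col_sum := by
    have : (1 : V → ℝ) ᵥ* sigmaMat a = sigma a := by
      ext j
      simp [sigmaMat, vecMul_diagonal]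
    rw [scaledLaplacian, ← vecMul_vecMul, this, sigma_vecMul_laplacian ha]

lemma scaledLaplacian_eq (a : V → V → ℝ) :
    scaledLaplacian a = -structureMat a + dissipationMat a := by
  ext i j
  simp only [structureMat, dissipationMat, Matrix.add_apply, Matrix.neg_apply,
    Matrix.smul_apply, Matrix.sub_apply, transpose_apply, smul_eq_mul]
  ring

lemma posSemidef_dissipationMat [Nonempty V] (ha : ∀ i j, 0 ≤ a i j) :
    (dissipationMat a).PosSemidef := by
  refine .of_dotProduct_mulVec_nonneg ?_ fun x => ?_
  · ext i j
    simp only [dissipationMat, conjTranspose_apply, Matrix.smul_apply, Matrix.add_apply,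
      transpose_apply, star_trivial, add_comm]
  · have h : x ⬝ᵥ (dissipationMat a *ᵥ x) = x ⬝ᵥ (scaledLaplacian a *ᵥ x) := by
      have ht : x ⬝ᵥ ((scaledLaplacian a)ᵀ *ᵥ x) = x ⬝ᵥ (scaledLaplacian a *ᵥ x) := by
        rw [mulVec_transpose, dotProduct_comm, dotProduct_mulVec]
      rw [dissipationMat, smul_mulVec, add_mulVec, dotProduct_smul, dotProduct_add, ht, smul_eq_mul]
      ring
    rw [star_trivial, h]
    exact (isBalancedLaplacian_scaledLaplacian ha).dotProduct_mulVec_nonneg x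

lemma transpose_structureMat (a : V → V → ℝ) : (structureMat a)ᵀ = -structureMat a := by
  simp [structureMat, transpose_sub, ← smul_neg]

lemma IsSolution.hasDerivWithinAt_lyapunov {x : ℝ → V → ℝ} (hx : IsSolution a x) {t : ℝ}
    (ht : 0 ≤ t) :
    HasDerivWithinAt (fun s => (1 / 2) * (x s ⬝ᵥ (sigmaMat a *ᵥ x s)))
      (-(x t ⬝ᵥ (scaledLaplacian a *ᵥ x t))) (Ici 0) t := by
  have h : HasDerivWithinAt (fun s => (1 / 2 : ℝ) * ∑ i, x s i * (sigma a i * x s i))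
      ((1 / 2 : ℝ) * ∑ i, (-(laplacian a *ᵥ x t) i * (sigma a i * x t i) +
        x t i * (sigma a i * -(laplacian a *ᵥ x t) i))) (Ici 0) t :=
    (HasDerivWithinAt.fun_sum fun i _ => (hx.hasDerivWithinAt_apply ht i).mul
      ((hx.hasDerivWithinAt_apply ht i).const_mul _)).const_mul _
  have hf : (fun s => (1 / 2) * (x s ⬝ᵥ (sigmaMat a *ᵥ x s))) =
      fun s => (1 / 2 : ℝ) * ∑ i, x s i * (sigma a i * x s i) := by
    funext s
    simp [dotProduct, sigmaMat, mulVec_diagonal]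
  rw [hf]
  refine h.congr_deriv ?_
  rw [scaledLaplacian, ← mulVec_mulVec, dotProduct, ← Finset.sum_neg_distrib, Finset.mul_sum]
  refine Finset.sum_congr rfl fun i _ => ?_
  rw [sigmaMat, mulVec_diagonal]
  ring

lemma inv_sigmaMat (hσ : ∀ j, 0 < sigma a j) :
    (sigmaMat a)⁻¹ = Matrix.diagonal fun j => (sigma a j)⁻¹ := by
  refine inv_eq_right_inv ?_
  rw [sigmaMat, diagonal_mul_diagonal, ← diagonal_one]
  congr 1
  funext j
  exact mul_inv_cancel₀ (hσ j).ne'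

lemma hasFDerivAt_hamiltonian (hσ : ∀ j, 0 < sigma a j) (z : V → ℝ) :
    HasFDerivAt (hamiltonian a)
      (∑ i, ((sigma a i)⁻¹ * z i) • (ContinuousLinearMap.proj i : (V → ℝ) →L[ℝ] ℝ)) z := by
  have hH : hamiltonian a = fun z => ∑ i, (2 * sigma a i)⁻¹ * z i ^ 2 := by
    funext z
    rw [hamiltonian, inv_sigmaMat hσ, dotProduct, Finset.mul_sum]
    refine Finset.sum_congr rfl fun i _ => ?_
    rw [mulVec_diagonal, mul_inv]
    ring
  rw [hH]
  refine HasFDerivAt.fun_sum fun i _ => ?_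
  have h := (((ContinuousLinearMap.proj i : (V → ℝ) →L[ℝ] ℝ).hasFDerivAt (x := z)).pow 2).const_mul
    ((2 * sigma a i)⁻¹)
  refine h.congr_fderiv ?_
  ext w
  simp
  ring

lemma partialGrad_hamiltonian (hσ : ∀ j, 0 < sigma a j) (z : V → ℝ) :
    partialGrad (hamiltonian a) z = (sigmaMat a)⁻¹ *ᵥ z := by
  funext i
  rw [partialGrad, (hasFDerivAt_hamiltonian hσ z).fderiv, inv_sigmaMat hσ, mulVec_diagonal]
  simp [Pi.single_apply]

lemma isSolution_iff_isPortHamiltonianSolution (hσ : ∀ j, 0 < sigma a j) (x : ℝ → V → ℝ) :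
    IsSolution a x ↔
      IsPortHamiltonianSolution (structureMat a) (dissipationMat a) (hamiltonian a)
        (fun t => sigmaMat a *ᵥ x t) := by
  refine forall₂_congr fun t _ => ?_
  have hunit : IsUnit (sigmaMat a).det := by
    rw [sigmaMat, det_diagonal]
    exact (Finset.prod_pos fun j _ => hσ j).ne'.isUnit
  have hJR : structureMat a - dissipationMat a = -scaledLaplacian a := by
    rw [scaledLaplacian_eq]
    abel
  have hrhs : (structureMat a - dissipationMat a) *ᵥ partialGrad (hamiltonian a) (sigmaMat a *ᵥ x t)
      = sigmaMat a *ᵥ -(laplacian a *ᵥ x t) := by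
    rw [partialGrad_hamiltonian hσ, hJR, mulVec_mulVec (x t), nonsing_inv_mul _ hunit, one_mulVec,
      neg_mulVec, scaledLaplacian, ← mulVec_mulVec, mulVec_neg]
  rw [hrhs, hasDerivWithinAt_pi, hasDerivWithinAt_pi]
  refine forall_congr' fun i => ?_
  simp only [sigmaMat, mulVec_diagonal]
  refine ⟨fun h => h.const_mul _, fun h => ?_⟩
  simpa [(hσ i).ne'] using h.const_mul (sigma a i)⁻¹

/-- The derivative is `-L x`, and the constant matrix `L` commutes with differentiation. -/
lemma isSolution_derivWithin {x : ℝ → V → ℝ} (hx : IsSolution a x) :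
    IsSolution a (fun t => derivWithin x (Ici 0) t) := by
  have hd : ∀ t, 0 ≤ t → derivWithin x (Ici 0) t = -(laplacian a *ᵥ x t) := fun t ht =>
    (hx t ht).derivWithin (uniqueDiffOn_Ici 0 t ht)
  intro t ht
  have h : HasDerivWithinAt (fun s => -(laplacian a *ᵥ x s))
      (-(laplacian a *ᵥ -(laplacian a *ᵥ x t))) (Ici 0) t :=
    ((Matrix.mulVecLin (laplacian a)).toContinuousLinearMap.hasFDerivAt.comp_hasDerivWithinAt t
      (hx t ht)).neg
  simp only [hd t ht]
  exact h.congr (fun s hs => hd s hs) (hd t ht)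

end Consensus

open Consensus in
theorem mainTheorem4 {V : Type*} [Fintype V] [DecidableEq V] [Nonempty V]
    (a : V → V → ℝ) (ha : ∀ i j, 0 ≤ a i j) :
    -- the matrix form of the agents' dynamics, and zero row sums
    (∀ (v : V → ℝ) (i : V),
      (laplacian a *ᵥ v) i = ∑ j ∈ inNeighbors a i, a i j * (v i - v j)) ∧
    laplacian a *ᵥ 1 = 0 ∧
    -- Matrix Tree theorem: the cofactors of `L_c`, and the left-kernel vector
    (∀ i j, (laplacian a).adjugate i j = sigma a j) ∧
    sigma a ᵥ* laplacian a = 0 ∧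
    -- conserved quantity
    (∀ x, IsSolution a x → ∀ t, 0 ≤ t →
      HasDerivWithinAt (fun s => ∑ j, sigma a j * x s j) 0 (Ici 0) t ∧
      ∑ j, sigma a j * x t j = ∑ j, sigma a j * x 0 j) ∧
    -- `σ` is positive exactly at the vertices that root spanning trees, and zero elsewhere
    (∀ j, IsRoot (graph a) j → 0 < sigma a j) ∧
    (∀ j, ¬ IsRoot (graph a) j → sigma a j = 0) ∧
    (sigma a ≠ 0 ↔ ∃ r, IsRoot (graph a) r) ∧
    -- convergence to consensus, and the consensus value
    ((∃ r, IsRoot (graph a) r) ↔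
      ∀ x, IsSolution a x → ∃ c : ℝ, Tendsto x atTop (𝓝 (fun _ => c))) ∧
    ((∃ r, IsRoot (graph a) r) → ∀ x, IsSolution a x →
      Tendsto x atTop (𝓝 (fun _ =>
        (∑ j ∈ roots a, sigma a j * x 0 j) / ∑ j ∈ roots a, sigma a j))) ∧
    ((∃ r, IsRoot (graph a) r) → ∀ x y, IsSolution a x → IsSolution a y →
      (∀ j, IsRoot (graph a) j → x 0 j = y 0 j) →
      ∃ c : ℝ, Tendsto x atTop (𝓝 (fun _ => c)) ∧ Tendsto y atTop (𝓝 (fun _ => c))) ∧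
    -- the strongly connected case
    (StronglyConnected (graph a) ↔ ∀ j, 0 < sigma a j) ∧
    (StronglyConnected (graph a) →
      IsBalancedLaplacian (scaledLaplacian a) ∧
      -- Lyapunov function
      (sigmaMat a).PosDef ∧
      (∀ x, IsSolution a x → ∀ t, 0 ≤ t →
        HasDerivWithinAt (fun s => (1 / 2) * (x s ⬝ᵥ (sigmaMat a *ᵥ x s)))
          (-(x t ⬝ᵥ (scaledLaplacian a *ᵥ x t))) (Ici 0) t ∧
        -(x t ⬝ᵥ (scaledLaplacian a *ᵥ x t)) ≤ 0) ∧
      (∀ x, IsSolution a x → Tendsto x atTop (𝓝 (fun _ =>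
        (∑ j, sigma a j * x 0 j) / ∑ j, sigma a j))) ∧
      -- port-Hamiltonian form
      scaledLaplacian a = -structureMat a + dissipationMat a ∧
      IsPortHamiltonian (structureMat a) (dissipationMat a) (hamiltonian a) ∧
      (∀ z, partialGrad (hamiltonian a) z = (sigmaMat a)⁻¹ *ᵥ z) ∧
      (∀ x, IsSolution a x ↔
        IsPortHamiltonianSolution (structureMat a) (dissipationMat a) (hamiltonian a)
          (fun t => sigmaMat a *ᵥ x t)) ∧
      (∀ x, IsSolution a x →
        IsPortHamiltonianSolution (structureMat a) (dissipationMat a) (hamiltonian a)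
          (fun t => sigmaMat a *ᵥ derivWithin x (Ici 0) t))) := by
  classical
  have hlim : ∀ {r : V}, IsRoot (graph a) r → ∀ {x : ℝ → V → ℝ}, IsSolution a x →
      Tendsto x atTop (𝓝 (fun _ =>
        (∑ j ∈ roots a, sigma a j * x 0 j) / ∑ j ∈ roots a, sigma a j)) := by
    intro r hr x hx
    have hden : ∑ j ∈ roots a, sigma a j = ∑ j, sigma a j := by
      simpa using sum_roots_eq a 1
    rw [sum_roots_eq a (x 0), hden]
    exact hx.tendsto_consensus ha hr
  refine ⟨laplacian_mulVec_eq_sum_inNeighbors ha, laplacian_mulVec_one a, adjugate_laplacian ha,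
    sigma_vecMul_laplacian ha,
    fun x hx t ht => ⟨hx.hasDerivWithinAt_sum_sigma ha ht, hx.sum_sigma_eq ha ht⟩,
    fun _ => sigma_pos, fun _ => sigma_eq_zero, sigma_ne_zero_iff,
    exists_isRoot_iff_forall_tendsto ha, fun ⟨_, hr⟩ x hx => hlim hr hx, ?_,
    stronglyConnected_iff ha, fun hsc => ?_⟩
  · rintro ⟨r, hr⟩ x y hx hy hxy
    refine ⟨_, hlim hr hx, ?_⟩
    have : ∑ j ∈ roots a, sigma a j * x 0 j = ∑ j ∈ roots a, sigma a j * y 0 j :=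
      Finset.sum_congr rfl fun j hj => by rw [hxy j (by simpa [roots] using hj)]
    rw [this]
    exact hlim hr hy
  · have hσ := (stronglyConnected_iff ha).mp hsc
    have hbal := isBalancedLaplacian_scaledLaplacian ha
    obtain ⟨r⟩ := ‹Nonempty V›
    have : Nonempty V := ⟨r⟩
    exact ⟨hbal, PosDef.diagonal hσ,
      fun x hx t ht => ⟨hx.hasDerivWithinAt_lyapunov ht,
        neg_nonpos.mpr (hbal.dotProduct_mulVec_nonneg (x t))⟩,
      fun x hx => hx.tendsto_consensus ha (sigma_pos_iff.mp (hσ r)),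
      scaledLaplacian_eq a,
      ⟨transpose_structureMat a, posSemidef_dissipationMat ha,
        fun z => (hasFDerivAt_hamiltonian hσ z).differentiableAt⟩,
      partialGrad_hamiltonian hσ, isSolution_iff_isPortHamiltonianSolution hσ,
      fun x hx => (isSolution_iff_isPortHamiltonianSolution hσ _).mp (isSolution_derivWithin hx)⟩
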